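/- Let $q$ be an odd prime power with $q\neq 9$, or let $q=2$, and let $F=GF(q)$ be the field with $q$ elements. Let $M^*(q)$ be the Paige loop over $F$: its elements are the vector matrices $$M=\begin{pmatrix} a & \alpha\\ \beta & b\end{pmatrix},\qquad a,b\in F,\ \alpha,\beta\in F^3,\qquad \det M=ab-\alpha\cdot\beta=1,$$ where $M$ is identified with $-M$, and its multiplication is the Zorn matrix multiplication $$\begin{pmatrix} a & \alpha\\ \beta & b\end{pmatrix}\begin{pmatrix} c & \gamma\\ \delta & d\end{pmatrix}=\begin{pmatrix} ac+\alpha\cdot\delta & a\gamma+d\alpha-\beta\times\delta\\ c\beta+b\delta+\alpha\times\gamma & \beta\cdot\gamma+bd\end{pmatrix},$$ with $\cdot$ and $\times$ the standard dot and cross products on $F^3$. Then the loop $M^*(q)$ is generated by three distinct elements of order $3$. Explicitly, let $e_1,e_2,e_3$ be the standard basis of $F^3$, let $u$ be any primitive element of $F$ (that is, a generator of the multiplicative group $F^\times$), and put $$g_1=\begin{pmatrix}1&e_1\\0&1\end{pmatrix},\quad g_2=\begin{pmatrix}1&e_2\\0&1\end{pmatrix},\quad g_3=\begin{pmatrix}0&ue_3\\-u^{-1}e_3&1\end{pmatrix},\quad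 g_4=g_3g_1,\quad g_5=g_3g_2.$$ Then $g_3,g_4,g_5$ are three distinct elements of order $3$, and the smallest subloop of $M^*(q)$ containing them is $M^*(q)$ itself. -/

import Mathlib

namespace PaigeLoop

/-- A loop: a set with a two-sided identity in which `a * x = b` and `y * a = b` have the unique
solutions `x = ldiv a b` and `y = rdiv b a`. -/
class Loop (L : Type*) extends MulOneClass L where
  ldiv : L → L → L
  rdiv : L → L → L
  mul_ldiv : ∀ a b : L, a * ldiv a b = b
  ldiv_mul : ∀ a b : L, ldiv a (a * b) = b
  rdiv_mul : ∀ a b : L, rdiv b a * a = b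
  mul_rdiv : ∀ a b : L, rdiv (b * a) a = b

/-- A subloop: a subset containing the identity and closed under multiplication and under
left and right division. -/
structure Subloop (L : Type*) [Loop L] extends Submonoid L where
  ldiv_mem : ∀ {a b : L}, a ∈ carrier → b ∈ carrier → Loop.ldiv a b ∈ carrier
  rdiv_mem : ∀ {a b : L}, a ∈ carrier → b ∈ carrier → Loop.rdiv b a ∈ carrier

/-- The subloop generated by a set `s`: the intersection of all subloops containing `s`. -/
def Subloop.closure {L : Type*} [Loop L] (s : Set L) : Subloop L where
  carrier := {x | ∀ H : Subloop L, s ⊆ H.carrier → x ∈ H.carrier}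
  one_mem' := fun H _ => H.one_mem'
  mul_mem' := fun ha hb H hs => H.mul_mem' (ha H hs) (hb H hs)
  ldiv_mem := fun ha hb H hs => H.ldiv_mem (ha H hs) (hb H hs)
  rdiv_mem := fun ha hb H hs => H.rdiv_mem (ha H hs) (hb H hs)

/-- The loop `L` is generated by the set `s`. -/
def Generates {L : Type*} [Loop L] (s : Set L) : Prop :=
  (Subloop.closure s).carrier = Set.univ

/-- The order of `x`: the least `n > 0` with `x * (x * (⋯ * (x * 1)))` (`n` factors `x`) equal
to `1`, and `0` if there is none. This is the definition of `orderOf` in a monoid. -/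
noncomputable def order {L : Type*} [Loop L] (x : L) : ℕ :=
  Function.minimalPeriod (fun y => x * y) 1

/-- Vector matrices `(a α; β b)` over `F`. -/
@[ext]
structure VectorMatrix (F : Type*) where
  a : F
  α : Fin 3 → F
  β : Fin 3 → F
  b : F

namespace VectorMatrix

variable {F : Type*} [Field F]

/-- Zorn matrix multiplication. -/
instance : Mul (VectorMatrix F) where
  mul M N :=
    { a := M.a * N.a + dotProduct M.α N.β
      α := M.a • N.α + N.b • M.α - crossProduct M.β N.β
      β := N.a • M.β + M.b • N.β + crossProduct M.α N.α
      b := dotProduct M.β N.α + M.b * N.b }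

instance : One (VectorMatrix F) where
  one := { a := 1, α := 0, β := 0, b := 1 }

instance : Neg (VectorMatrix F) where
  neg M := { a := -M.a, α := -M.α, β := -M.β, b := -M.b }

def det (M : VectorMatrix F) : F := M.a * M.b - dotProduct M.α M.β

/-- The conjugate of `M`, which is the inverse of `M` when `det M = 1`. -/
def conj (M : VectorMatrix F) : VectorMatrix F :=
  { a := M.b, α := -M.α, β := -M.β, b := M.a }

theorem mul_def (M N : VectorMatrix F) : M * N =
    { a := M.a * N.a + dotProduct M.α N.β
      α := M.a • N.α + N.b • M.α - crossProduct M.β N.β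
      β := N.a • M.β + M.b • N.β + crossProduct M.α N.α
      b := dotProduct M.β N.α + M.b * N.b } := rfl

theorem one_def : (1 : VectorMatrix F) = { a := 1, α := 0, β := 0, b := 1 } := rfl

theorem neg_def (M : VectorMatrix F) :
    -M = { a := -M.a, α := -M.α, β := -M.β, b := -M.b } := rfl

theorem det_mul (M N : VectorMatrix F) : (M * N).det = M.det * N.det := by
  simp [det, mul_def, dotProduct, Fin.sum_univ_three, cross_apply, Matrix.vecHead, Matrix.vecTail]
  ring

theorem det_one : (1 : VectorMatrix F).det = 1 := by simp [det, one_def]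

theorem det_neg (M : VectorMatrix F) : (-M).det = M.det := by simp [det, neg_def]

theorem det_conj (M : VectorMatrix F) : M.conj.det = M.det := by simp [det, conj, mul_comm]

theorem one_mul' (M : VectorMatrix F) : 1 * M = M := by
  ext i <;> simp [mul_def, one_def]

theorem mul_one' (M : VectorMatrix F) : M * 1 = M := by
  ext i <;> simp [mul_def, one_def]

theorem neg_neg' (M : VectorMatrix F) : -(-M) = M := by ext i <;> simp [neg_def]

theorem neg_mul' (M N : VectorMatrix F) : -M * N = -(M * N) := by
  ext i
  · simp [mul_def, neg_def]
    ring
  · fin_cases i <;>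
      simp [mul_def, neg_def, cross_apply, Matrix.vecHead, Matrix.vecTail] <;> ring
  · fin_cases i <;>
      simp [mul_def, neg_def, cross_apply, Matrix.vecHead, Matrix.vecTail] <;> ring
  · simp [mul_def, neg_def]
    ring

theorem mul_neg' (M N : VectorMatrix F) : M * -N = -(M * N) := by
  ext i
  · simp [mul_def, neg_def]
    ring
  · fin_cases i <;>
      simp [mul_def, neg_def, cross_apply, Matrix.vecHead, Matrix.vecTail] <;> ring
  · fin_cases i <;>
      simp [mul_def, neg_def, cross_apply, Matrix.vecHead, Matrix.vecTail] <;> ring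
  · simp [mul_def, neg_def]
    ring

theorem conj_neg (M : VectorMatrix F) : (-M).conj = -M.conj := by
  ext i <;> simp [conj, neg_def]

theorem conj_conj (M : VectorMatrix F) : M.conj.conj = M := by
  ext i <;> simp [conj]

theorem conj_mul_cancel (M N : VectorMatrix F) (h : M.det = 1) : M.conj * (M * N) = N := by
  simp only [det, dotProduct, Fin.sum_univ_three] at h
  ext i
  · simp [mul_def, conj, dotProduct, Fin.sum_univ_three, cross_apply, Matrix.vecHead, Matrix.vecTail]
    linear_combination N.a * h
  · fin_cases i <;> simp [mul_def, conj, dotProduct, Fin.sum_univ_three, cross_apply, Matrix.vecHead, Matrix.vecTail]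
    · linear_combination N.α 0 * h
    · linear_combination N.α 1 * h
    · linear_combination N.α 2 * h
  · fin_cases i <;> simp [mul_def, conj, dotProduct, Fin.sum_univ_three, cross_apply, Matrix.vecHead, Matrix.vecTail]
    · linear_combination N.β 0 * h
    · linear_combination N.β 1 * h
    · linear_combination N.β 2 * h
  · simp [mul_def, conj, dotProduct, Fin.sum_univ_three, cross_apply, Matrix.vecHead, Matrix.vecTail]
    linear_combination N.b * h

theorem mul_conj_cancel (M N : VectorMatrix F) (h : M.det = 1) : (N * M) * M.conj = N := by
  simp only [det, dotProduct, Fin.sum_univ_three] at h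
  ext i
  · simp [mul_def, conj, dotProduct, Fin.sum_univ_three, cross_apply, Matrix.vecHead, Matrix.vecTail]
    linear_combination N.a * h
  · fin_cases i <;> simp [mul_def, conj, dotProduct, Fin.sum_univ_three, cross_apply, Matrix.vecHead, Matrix.vecTail]
    · linear_combination N.α 0 * h
    · linear_combination N.α 1 * h
    · linear_combination N.α 2 * h
  · fin_cases i <;> simp [mul_def, conj, dotProduct, Fin.sum_univ_three, cross_apply, Matrix.vecHead, Matrix.vecTail]
    · linear_combination N.β 0 * h
    · linear_combination N.β 1 * h
    · linear_combination N.β 2 * h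
  · simp [mul_def, conj, dotProduct, Fin.sum_univ_three, cross_apply, Matrix.vecHead, Matrix.vecTail]
    linear_combination N.b * h

/-- The identification of `M` with `-M` on vector matrices of determinant `1`. -/
instance signSetoid (F : Type*) [Field F] : Setoid {M : VectorMatrix F // M.det = 1} where
  r M N := M.1 = N.1 ∨ M.1 = -N.1
  iseqv :=
    { refl := fun _ => Or.inl rfl
      symm := by
        rintro M N (h | h)
        · exact Or.inl h.symm
        · exact Or.inr (by rw [h, neg_neg'])
      trans := by
        rintro M N P (h | h) (k | k)
        · exact Or.inl (h.trans k)
        · exact Or.inr (h.trans k)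
        · exact Or.inr (by rw [h, k])
        · exact Or.inl (by rw [h, k, neg_neg']) }

end VectorMatrix

/-- The Paige loop over `F`: vector matrices of determinant `1`, with `M` identified
with `-M`. -/
def Paige (F : Type*) [Field F] : Type _ := Quotient (VectorMatrix.signSetoid F)

namespace Paige

open VectorMatrix

variable {F : Type*} [Field F]

/-- The class of a vector matrix of determinant `1` in the Paige loop. -/
def mk (M : VectorMatrix F) (h : M.det = 1) : Paige F :=
  Quotient.mk (signSetoid F) ⟨M, h⟩

instance : Mul (Paige F) where
  mul := Quotient.map₂ (fun M N => ⟨M.1 * N.1, by rw [det_mul, M.2, N.2, one_mul]⟩) (by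
    rintro M M' (h | h) N N' (k | k)
    · exact Or.inl (by simp only [h, k])
    · exact Or.inr (by simp only [h, k, mul_neg'])
    · exact Or.inr (by simp only [h, k, neg_mul'])
    · exact Or.inl (by simp only [h, k, neg_mul', mul_neg', neg_neg']))

instance : One (Paige F) where
  one := mk 1 det_one

/-- The inverse, induced by conjugation of vector matrices. -/
instance : Inv (Paige F) where
  inv := Quotient.map (fun M => ⟨M.1.conj, by rw [det_conj, M.2]⟩) (by
    rintro M M' (h | h)
    · exact Or.inl (by simp only [h])
    · exact Or.inr (by simp only [h, conj_neg]))

instance : Loop (Paige F) where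
  one_mul := by
    rintro ⟨M⟩
    exact congrArg (Quotient.mk _) (Subtype.ext (one_mul' M.1))
  mul_one := by
    rintro ⟨M⟩
    exact congrArg (Quotient.mk _) (Subtype.ext (mul_one' M.1))
  ldiv a b := a⁻¹ * b
  rdiv b a := b * a⁻¹
  mul_ldiv := by
    rintro ⟨M⟩ ⟨N⟩
    refine congrArg (Quotient.mk _) (Subtype.ext ?_)
    have h := conj_mul_cancel M.1.conj N.1 (by rw [det_conj, M.2])
    rwa [conj_conj] at h
  ldiv_mul := by
    rintro ⟨M⟩ ⟨N⟩
    exact congrArg (Quotient.mk _) (Subtype.ext (conj_mul_cancel M.1 N.1 M.2))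
  rdiv_mul := by
    rintro ⟨M⟩ ⟨N⟩
    refine congrArg (Quotient.mk _) (Subtype.ext ?_)
    have h := mul_conj_cancel M.1.conj N.1 (by rw [det_conj, M.2])
    rwa [conj_conj] at h
  mul_rdiv := by
    rintro ⟨M⟩ ⟨N⟩
    exact congrArg (Quotient.mk _) (Subtype.ext (mul_conj_cancel M.1 N.1 M.2))

/-- `g₁ = (1 e₁; 0 1)` -/
def g₁ (F : Type*) [Field F] : Paige F :=
  mk { a := 1, α := ![1, 0, 0], β := 0, b := 1 } (by simp [det])

/-- `g₂ = (1 e₂; 0 1)` -/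
def g₂ (F : Type*) [Field F] : Paige F :=
  mk { a := 1, α := ![0, 1, 0], β := 0, b := 1 } (by simp [det])

/-- `g₃ = (0 u•e₃; -u⁻¹•e₃ 1)` -/
def g₃ (u : Fˣ) : Paige F :=
  mk { a := 0, α := ![0, 0, (u : F)], β := ![0, 0, -(u : F)⁻¹], b := 1 }
    (by simp [det, dotProduct, Fin.sum_univ_three])

/-- `g₄ = g₃ g₁` -/
def g₄ (u : Fˣ) : Paige F := g₃ u * g₁ F

/-- `g₅ = g₃ g₂` -/
def g₅ (u : Fˣ) : Paige F := g₃ u * g₂ F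

end Paige

end PaigeLoop

/-!
Call `(1 te_i; 0 1)` and `(1 0; te_i 1)` root elements. The root elements generate the Paige loop
over any field: multiplying a vector matrix of determinant `1` on the left by root elements, one
reaches `a = 1`, then `β = 0` and `b = 1`, and `(1 α; 0 1)` is a product of root elements
(`Subloop.mem_lift_of_det_eq_one`). It therefore suffices to find all root elements in the subloop
`H` generated by `g₃`, `g₄`, `g₅`. Left division gives `g₁, g₂ ∈ H`. Write `S_i` and `T_i` for the
additive groups of those `t` for which `(1 te_i; 0 1)`, respectively `(1 0; te_i 1)`, lies over `H`.

If `q` is odd, the commutator of `(1 α; 0 1)` and `(1 γ; 0 1)` is `(1 0; 2 α × γ 1)`, and halving is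
possible, so that `S_i S_{i+1} ⊆ T_{i+2}`; likewise `T_i T_{i+1} ⊆ S_{i+2}`. Conjugation by `g₃`
gives `u² T₃ ⊆ S₃`. Starting from `1 ∈ S₁` and `1 ∈ S₂`, these inclusions show
`u² T₃ ⊆ T₃` and `1 ∈ T₃`. Hence `T₃` contains all squares, as `u` is primitive, and so all of `F`,
because `4x = (x + 1)² - (x - 1)²`. The other five groups are then equal to `F` by the same
inclusions. The argument takes place in the loop and not in a subgroup `SL₂(q)`, so it needs no
classification of the subgroups of `SL₂(q)`, and in particular `q = 9` plays no special role in it.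

If `q = 2`, commutators of root elements of equal sign are trivial, and the missing root elements
are written down as explicit words in `g₁`, `g₂`, `g₃`.

The elements `g₃`, `g₄`, `g₅` have trace `1`, so that their representatives satisfy `M³ = -1`
(`VectorMatrix.mul_mul_mul_one`); this gives the orders.
-/

/-! ### Additive groups of odd order -/

/-- If the order is `2k + 1`, then `x = -k • (2 • x)`. -/
theorem AddSubgroup.mem_of_two_nsmul_mem {A : Type*} [AddCommGroup A]
    (hA : Odd (Nat.card A)) {K : AddSubgroup A} {x : A} (hx : 2 • x ∈ K) : x ∈ K := by
  obtain ⟨k, hk⟩ := hA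
  have h : Nat.card A • x = 0 := card_nsmul_eq_zero'
  rw [hk, add_nsmul, one_nsmul, mul_nsmul] at h
  rw [eq_neg_of_add_eq_zero_right h]
  exact neg_mem (nsmul_mem hx k)

namespace PaigeLoop

/-! ### Identities between vector matrices -/

namespace VectorMatrix

variable {F : Type*} [Field F]

/-- The unipotent element `(1 α; 0 1)`. -/
def upper (α : Fin 3 → F) : VectorMatrix F := { a := 1, α := α, β := 0, b := 1 }

/-- The unipotent element `(1 0; β 1)`. -/
def lower (β : Fin 3 → F) : VectorMatrix F := { a := 1, α := 0, β := β, b := 1 }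

theorem det_upper (α : Fin 3 → F) : (upper α).det = 1 := by simp [det, upper]

theorem det_lower (β : Fin 3 → F) : (lower β).det = 1 := by simp [det, lower]

theorem conj_upper (α : Fin 3 → F) : (upper α).conj = upper (-α) := by simp [conj, upper]

theorem conj_lower (β : Fin 3 → F) : (lower β).conj = lower (-β) := by simp [conj, lower]

/-- The commutator of two upper unipotent elements. -/
theorem upper_mul_upper_mul_conj (α γ : Fin 3 → F) :
    (upper α * upper γ) * (upper γ * upper α).conj = lower (2 • crossProduct α γ) := by
  ext i
  · simp [mul_def, conj, upper, lower]
  · fin_cases i <;> simp [mul_def, conj, upper, lower, cross_apply] <;> ring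
  · fin_cases i <;> simp [mul_def, conj, upper, lower, cross_apply] <;> ring
  · simp [mul_def, conj, upper, lower, dotProduct, Fin.sum_univ_three, cross_apply]
    ring

/-- The commutator of two lower unipotent elements. -/
theorem lower_mul_lower_mul_conj (β δ : Fin 3 → F) :
    (lower δ * lower β) * (lower β * lower δ).conj = upper (2 • crossProduct β δ) := by
  ext i
  · simp [mul_def, conj, upper, lower, dotProduct, Fin.sum_univ_three, cross_apply]
    ring
  · fin_cases i <;> simp [mul_def, conj, upper, lower, cross_apply] <;> ring
  · fin_cases i <;> simp [mul_def, conj, upper, lower, cross_apply] <;> ring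
  · simp [mul_def, conj, upper, lower]

theorem lower_mul_upper_mul_upper (α γ : Fin 3 → F) :
    lower (-crossProduct α γ) * (upper α * upper γ) = upper (α + γ) := by
  ext i
  · simp [mul_def, upper, lower]
  · simp [mul_def, upper, lower, -cross_anticomm, add_comm]
  · fin_cases i <;> simp [mul_def, upper, lower, cross_apply]
  · simp [mul_def, upper, lower, dotProduct, Fin.sum_univ_three, cross_apply]
    ring

theorem upper_mul_lower_mul_lower (β δ : Fin 3 → F) :
    upper (crossProduct β δ) * (lower β * lower δ) = lower (β + δ) := by
  ext i
  · simp [mul_def, upper, lower, dotProduct, Fin.sum_univ_three, cross_apply]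
    ring
  · fin_cases i <;> simp [mul_def, upper, lower, cross_apply]
  · simp [mul_def, upper, lower, -cross_anticomm, add_comm]
  · simp [mul_def, upper, lower]

theorem upper_single_mul (M : VectorMatrix F) (i : Fin 3) (t : F) :
    upper (Pi.single i t) * M =
      { a := M.a + t * M.β i
        α := M.α + M.b • Pi.single i t
        β := M.β + crossProduct (Pi.single i t) M.α
        b := M.b } := by
  ext j <;> simp [mul_def, upper]

theorem lower_single_mul (M : VectorMatrix F) (i : Fin 3) (t : F) :
    lower (Pi.single i t) * M =
      { a := M.a
        α := M.α - crossProduct (Pi.single i t) M.β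
        β := M.a • Pi.single i t + M.β
        b := t * M.α i + M.b } := by
  ext j <;> simp [mul_def, lower]

/-- A vector matrix of determinant and trace `1` satisfies `M² - M + 1 = 0`, whence `M³ = -1`. -/
theorem mul_mul_mul_one (M : VectorMatrix F) (hd : M.det = 1) (ht : M.a + M.b = 1) :
    M * (M * (M * 1)) = -1 := by
  have h2 : M * M = { a := M.a - 1, α := M.α, β := M.β, b := M.b - 1 } := by
    simp only [det] at hd
    ext i
    · simp only [mul_def]
      linear_combination M.a * ht - hd
    · simp only [mul_def, cross_self, sub_zero, Pi.add_apply, Pi.smul_apply, smul_eq_mul]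
      linear_combination M.α i * ht
    · simp only [mul_def, cross_self, add_zero, Pi.add_apply, Pi.smul_apply, smul_eq_mul]
      linear_combination M.β i * ht
    · simp only [mul_def, dotProduct_comm M.β]
      linear_combination M.b * ht - hd
  simp only [det] at hd
  rw [mul_one', h2]
  ext i
  · simp only [mul_def, neg_def, one_def]
    linear_combination M.a * ht - hd
  · simp only [mul_def, neg_def, one_def, cross_self, sub_zero, Pi.add_apply, Pi.smul_apply,
      smul_eq_mul, Pi.neg_apply, Pi.zero_apply]
    linear_combination M.α i * ht
  · simp only [mul_def, neg_def, one_def, cross_self, add_zero, Pi.add_apply, Pi.smul_apply,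
      smul_eq_mul, Pi.neg_apply, Pi.zero_apply]
    linear_combination M.β i * ht
  · simp only [mul_def, neg_def, one_def, dotProduct_comm M.β]
    linear_combination M.b * ht - hd

/-- The representative `(0 ue₃; -u⁻¹e₃ 1)` of the generator `Paige.g₃ u`. -/
def g₃Rep (u : Fˣ) : VectorMatrix F :=
  { a := 0, α := ![0, 0, (u : F)], β := ![0, 0, -(u : F)⁻¹], b := 1 }

theorem det_g₃Rep (u : Fˣ) : (g₃Rep u).det = 1 := by
  simp [det, g₃Rep, dotProduct, Fin.sum_univ_three]

/-- `g₃` conjugates lower root elements in the direction `e₃` to upper ones, scaling by `-u²`. -/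
theorem conj_g₃Rep_mul_lower_mul (u : Fˣ) (t : F) :
    (g₃Rep u).conj * (lower (Pi.single 2 t) * g₃Rep u) = upper (Pi.single 2 (-(u ^ 2 * t))) := by
  ext i
  · simp [mul_def, conj, lower, upper, g₃Rep, dotProduct, Fin.sum_univ_three]
  · fin_cases i <;> simp [mul_def, conj, lower, upper, g₃Rep, cross_apply]
    ring
  · fin_cases i <;> simp [mul_def, conj, lower, upper, g₃Rep, cross_apply]
  · simp [mul_def, conj, lower, upper, g₃Rep, dotProduct, Fin.sum_univ_three, cross_apply]

theorem single_zero_eq_vec (t : F) : (Pi.single 0 t : Fin 3 → F) = ![t, 0, 0] := by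
  ext i; fin_cases i <;> simp

theorem single_one_eq_vec (t : F) : (Pi.single 1 t : Fin 3 → F) = ![0, t, 0] := by
  ext i; fin_cases i <;> simp

theorem single_two_eq_vec (t : F) : (Pi.single 2 t : Fin 3 → F) = ![0, 0, t] := by
  ext i; fin_cases i <;> simp

theorem conj_g₃Rep_one_mul_upper_one_mul :
    (g₃Rep 1).conj * (upper ![0, 1, 0] * g₃Rep 1) = lower ![(1 : F), 0, 0] := by
  ext i
  · simp [mul_def, conj, upper, lower, g₃Rep, cross_apply]
  · fin_cases i <;> simp [mul_def, conj, upper, lower, g₃Rep, cross_apply]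
  · fin_cases i <;> simp [mul_def, conj, upper, lower, g₃Rep, cross_apply]
  · simp [mul_def, conj, upper, lower, g₃Rep, cross_apply]

theorem conj_g₃Rep_one_mul_upper_zero_mul [CharP F 2] :
    (g₃Rep 1).conj * (upper ![1, 0, 0] * g₃Rep 1) = lower ![(0 : F), 1, 0] := by
  ext i
  · simp [mul_def, conj, upper, lower, g₃Rep, cross_apply]
  · fin_cases i <;> simp [mul_def, conj, upper, lower, g₃Rep, cross_apply]
  · fin_cases i <;> simp [mul_def, conj, upper, lower, g₃Rep, cross_apply, CharTwo.neg_eq]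
  · simp [mul_def, conj, upper, lower, g₃Rep, cross_apply]

/-- In characteristic `2` this word replaces the commutator of `g₁` and `g₂`, which is trivial. -/
theorem upper_mul_lower_mul_conj_g₃Rep_one [CharP F 2] :
    upper ![1, 0, 0] * (lower ![1, 0, 0] * ((g₃Rep 1).conj * (lower ![0, 1, 0] *
      upper ![0, 1, 0]))) = lower ![(0 : F), 0, 1] := by
  ext i
  · simp [mul_def, conj, upper, lower, g₃Rep, cross_apply, CharTwo.add_self_eq_zero]
  · fin_cases i <;> simp [mul_def, conj, upper, lower, g₃Rep, cross_apply,
      CharTwo.add_self_eq_zero]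
  · fin_cases i <;> simp [mul_def, conj, upper, lower, g₃Rep, cross_apply,
      CharTwo.add_self_eq_zero]
  · simp [mul_def, conj, upper, lower, g₃Rep, cross_apply, CharTwo.add_self_eq_zero]

theorem cross_single_self (i : Fin 3) (s t : F) :
    crossProduct (Pi.single i s) (Pi.single i t) = 0 := by
  ext j; fin_cases i <;> fin_cases j <;> simp [cross_apply]

theorem cross_single_single_add_one (i : Fin 3) (s t : F) :
    crossProduct (Pi.single i s) (Pi.single (i + 1) t) = Pi.single (i + 2) (s * t) := by
  ext j; fin_cases i <;> fin_cases j <;> simp [cross_apply]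

theorem cross_single_zero_one (s t : F) :
    crossProduct (Pi.single 0 s) (Pi.single 1 t) = Pi.single 2 (s * t) :=
  cross_single_single_add_one 0 s t

end VectorMatrix

/-! ### Root elements generate the Paige loop -/

open VectorMatrix

variable {F : Type*} [Field F]

/-- The vector matrices of determinant `1` whose class lies in the subloop `H`. Working with
representatives makes the membership of explicit products a matter of vector matrix identities. -/
def Subloop.lift (H : Subloop (Paige F)) : Set (VectorMatrix F) :=
  {M | ∃ h : M.det = 1, Paige.mk M h ∈ H.carrier}

namespace Subloop

variable {H : Subloop (Paige F)} {M N : VectorMatrix F}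

theorem mul_mem_lift (hM : M ∈ H.lift) (hN : N ∈ H.lift) : M * N ∈ H.lift := by
  obtain ⟨hM, hM'⟩ := hM
  obtain ⟨hN, hN'⟩ := hN
  exact ⟨by rw [det_mul, hM, hN, one_mul], H.mul_mem' hM' hN'⟩

theorem conj_mem_lift (hM : M ∈ H.lift) : M.conj ∈ H.lift := by
  obtain ⟨hM, hM'⟩ := hM
  have h := H.ldiv_mem hM' H.one_mem'
  rw [show Loop.ldiv (Paige.mk M hM) 1 = (Paige.mk M hM)⁻¹ from mul_one (Paige.mk M hM)⁻¹] at h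
  exact ⟨by rw [det_conj, hM], h⟩

theorem mul_mem_lift_iff (hM : M ∈ H.lift) : M * N ∈ H.lift ↔ N ∈ H.lift := by
  refine ⟨fun h => ?_, mul_mem_lift hM⟩
  have := mul_mem_lift (conj_mem_lift hM) h
  rwa [conj_mul_cancel M N hM.1] at this

theorem upper_neg_mem {α : Fin 3 → F} (h : upper α ∈ H.lift) : upper (-α) ∈ H.lift := by
  simpa [conj_upper] using conj_mem_lift h

theorem lower_neg_mem {α : Fin 3 → F} (h : lower α ∈ H.lift) : lower (-α) ∈ H.lift := by
  simpa [conj_lower] using conj_mem_lift h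

theorem upper_add_mem {α γ : Fin 3 → F} (hα : upper α ∈ H.lift) (hγ : upper γ ∈ H.lift)
    (h : lower (crossProduct α γ) ∈ H.lift) : upper (α + γ) ∈ H.lift := by
  rw [← lower_mul_upper_mul_upper]
  exact mul_mem_lift (lower_neg_mem h) (mul_mem_lift hα hγ)

theorem lower_add_mem {α γ : Fin 3 → F} (hα : lower α ∈ H.lift) (hγ : lower γ ∈ H.lift)
    (h : upper (crossProduct α γ) ∈ H.lift) : lower (α + γ) ∈ H.lift := by
  rw [← upper_mul_lower_mul_lower]
  exact mul_mem_lift h (mul_mem_lift hα hγ)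

theorem lower_two_cross_mem {α γ : Fin 3 → F} (hα : upper α ∈ H.lift) (hγ : upper γ ∈ H.lift) :
    lower (2 • crossProduct α γ) ∈ H.lift := by
  rw [← upper_mul_upper_mul_conj]
  exact mul_mem_lift (mul_mem_lift hα hγ) (conj_mem_lift (mul_mem_lift hγ hα))

theorem upper_two_cross_mem {α γ : Fin 3 → F} (hα : lower α ∈ H.lift) (hγ : lower γ ∈ H.lift) :
    upper (2 • crossProduct α γ) ∈ H.lift := by
  rw [← lower_mul_lower_mul_conj]
  exact mul_mem_lift (mul_mem_lift hγ hα) (conj_mem_lift (mul_mem_lift hα hγ))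

/-- Once all root elements are available, sums over two roots come from the third root of the
opposite sign, and sums over three roots from the two-root case. -/
theorem upper_mem (hU : ∀ i t, upper (Pi.single i t) ∈ H.lift)
    (hL : ∀ i t, lower (Pi.single i t) ∈ H.lift) (α : Fin 3 → F) : upper α ∈ H.lift := by
  have hL2 (x y : F) : lower ![x, y, 0] ∈ H.lift := by
    have h := lower_add_mem (hL 0 x) (hL 1 y) (cross_single_zero_one x y ▸ hU 2 _)
    convert h using 2
    ext i; fin_cases i <;> simp
  have hU2 (x y : F) : upper ![x, y, 0] ∈ H.lift := by
    have h := upper_add_mem (hU 0 x) (hU 1 y) (cross_single_zero_one x y ▸ hL 2 _)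
    convert h using 2
    ext i; fin_cases i <;> simp
  have h := upper_add_mem (hU2 (α 0) (α 1)) (hU 2 (α 2)) (by
    convert hL2 (α 1 * α 2) (-(α 0 * α 2)) using 2
    ext i; fin_cases i <;> simp [cross_apply])
  convert h using 2
  ext i; fin_cases i <;> simp

/-- The root elements generate: they bring a vector matrix of determinant `1` first to `a = 1`,
then to `β = 0`, which forces `b = 1`. -/
theorem mem_lift_of_det_eq_one (hU : ∀ i t, upper (Pi.single i t) ∈ H.lift)
    (hL : ∀ i t, lower (Pi.single i t) ∈ H.lift) (M : VectorMatrix F) (hM : M.det = 1) :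
    M ∈ H.lift := by
  have h₀ (M : VectorMatrix F) (hM : M.det = 1) (ha : M.a = 1) (hβ : M.β = 0) : M ∈ H.lift := by
    have hb : M.b = 1 := by simpa [det, ha, hβ] using hM
    convert upper_mem hU hL M.α using 1
    ext i <;> simp [upper, ha, hβ, hb]
  -- `(1 0; -β_i e_i 1)` clears the `i`-th coordinate of `β` and keeps `a = 1`.
  have hclear (i : Fin 3) (M : VectorMatrix F) (hM : M.det = 1) (ha : M.a = 1)
      (h : ∀ N : VectorMatrix F, N.det = 1 → N.a = 1 → N.β = Function.update M.β i 0 →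
        N ∈ H.lift) : M ∈ H.lift := by
    rw [← mul_mem_lift_iff (hL i (-M.β i))]
    apply h
    · rw [det_mul, det_lower, hM, one_mul]
    · simp [lower_single_mul, ha]
    · ext j
      by_cases hj : j = i
      · subst hj; simp [lower_single_mul, ha]
      · simp [lower_single_mul, hj]
  have h₁ (M : VectorMatrix F) (hM : M.det = 1) (ha : M.a = 1) : M ∈ H.lift := by
    refine hclear 0 M hM ha fun N hN ha hβ => ?_
    refine hclear 1 N hN ha fun N' hN ha hβ' => ?_
    refine hclear 2 N' hN ha fun N'' hN ha hβ'' => ?_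
    refine h₀ N'' hN ha ?_
    ext i; fin_cases i <;> simp [hβ'', hβ', hβ]
  have h₂ (M : VectorMatrix F) (hM : M.det = 1) (i : Fin 3) (hi : M.β i ≠ 0) : M ∈ H.lift := by
    rw [← mul_mem_lift_iff (hU i ((1 - M.a) / M.β i))]
    apply h₁
    · rw [det_mul, det_upper, hM, one_mul]
    · simp [upper_single_mul, hi]
  by_cases hβ : M.β = 0
  · have ha : M.a ≠ 0 := by
      intro ha
      simp [det, ha, hβ] at hM
    rw [← mul_mem_lift_iff (hL 0 1)]
    refine h₂ _ (by rw [det_mul, det_lower, hM, one_mul]) 0 ?_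
    simp [lower_single_mul, hβ, ha]
  · obtain ⟨i, hi⟩ := Function.ne_iff.mp hβ
    exact h₂ M hM i hi

/-! ### The root groups of a subloop -/

/-- The parameters `t` of the root elements `(1 te_i; 0 1)` lying over `H`. -/
def upperRoot (H : Subloop (Paige F)) (i : Fin 3) : AddSubgroup F where
  carrier := {t | upper (Pi.single i t) ∈ H.lift}
  zero_mem' := by
    rw [Set.mem_ofPred_eq, Pi.single_zero]
    exact ⟨det_upper 0, H.one_mem'⟩
  add_mem' {s t} hs ht := by
    rw [Set.mem_ofPred_eq, Pi.single_add]
    refine upper_add_mem hs ht ?_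
    rw [cross_single_self]
    exact ⟨det_lower 0, H.one_mem'⟩
  neg_mem' {t} ht := by
    rw [Set.mem_ofPred_eq, Pi.single_neg]
    exact upper_neg_mem ht

/-- The parameters `t` of the root elements `(1 0; te_i 1)` lying over `H`. -/
def lowerRoot (H : Subloop (Paige F)) (i : Fin 3) : AddSubgroup F where
  carrier := {t | lower (Pi.single i t) ∈ H.lift}
  zero_mem' := by
    rw [Set.mem_ofPred_eq, Pi.single_zero]
    exact ⟨det_lower 0, H.one_mem'⟩
  add_mem' {s t} hs ht := by
    rw [Set.mem_ofPred_eq, Pi.single_add]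
    refine lower_add_mem hs ht ?_
    rw [cross_single_self]
    exact ⟨det_upper 0, H.one_mem'⟩
  neg_mem' {t} ht := by
    rw [Set.mem_ofPred_eq, Pi.single_neg]
    exact lower_neg_mem ht

theorem mem_upperRoot {i : Fin 3} {t : F} :
    t ∈ H.upperRoot i ↔ upper (Pi.single i t) ∈ H.lift := Iff.rfl

theorem mem_lowerRoot {i : Fin 3} {t : F} :
    t ∈ H.lowerRoot i ↔ lower (Pi.single i t) ∈ H.lift := Iff.rfl

theorem mul_mem_lowerRoot (hF : Odd (Nat.card F)) (i : Fin 3) {s t : F}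
    (hs : s ∈ H.upperRoot i) (ht : t ∈ H.upperRoot (i + 1)) :
    s * t ∈ H.lowerRoot (i + 2) := by
  apply AddSubgroup.mem_of_two_nsmul_mem hF
  rw [mem_lowerRoot, Pi.single_smul, ← cross_single_single_add_one]
  exact lower_two_cross_mem hs ht

theorem mul_mem_upperRoot (hF : Odd (Nat.card F)) (i : Fin 3) {s t : F}
    (hs : s ∈ H.lowerRoot i) (ht : t ∈ H.lowerRoot (i + 1)) :
    s * t ∈ H.upperRoot (i + 2) := by
  apply AddSubgroup.mem_of_two_nsmul_mem hF
  rw [mem_upperRoot, Pi.single_smul, ← cross_single_single_add_one]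
  exact upper_two_cross_mem hs ht

theorem sq_mul_mem_upperRoot (u : Fˣ) (h : g₃Rep u ∈ H.lift) {t : F} (ht : t ∈ H.lowerRoot 2) :
    (u : F) ^ 2 * t ∈ H.upperRoot 2 := by
  rw [← neg_mem_iff, mem_upperRoot, ← conj_g₃Rep_mul_lower_mul]
  exact mul_mem_lift (conj_mem_lift h) (mul_mem_lift ht h)

/-- The group `T` of parameters `t` with `(1 0; te₃ 1)` over `H` is closed under multiplication by
`u²`, by way of `(1 u²te₃; 0 1)`, `(1 0; u²te₁ 1)` and `(1 u²te₂; 0 1)`. As `1 ∈ T`, it contains all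
squares, hence all of `F`; the other root groups follow. -/
theorem upperRoot_lowerRoot_eq_top_of_odd [Finite F] (hF : Odd (Nat.card F)) (u : Fˣ)
    (hu : ∀ v : Fˣ, v ∈ Subgroup.zpowers u) (h₁ : 1 ∈ H.upperRoot 0) (h₂ : 1 ∈ H.upperRoot 1)
    (h₃ : g₃Rep u ∈ H.lift) (i : Fin 3) : H.upperRoot i = ⊤ ∧ H.lowerRoot i = ⊤ := by
  have h1 : (1 : F) ∈ H.lowerRoot 2 := by simpa using mul_mem_lowerRoot hF 0 h₁ h₂
  have key {t : F} (ht : t ∈ H.lowerRoot 2) : (u : F) ^ 2 * t ∈ H.lowerRoot 2 := by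
    have h := sq_mul_mem_upperRoot u h₃ ht
    have hT0 := mul_mem_lowerRoot hF 1 h₂ h
    have hS1 := mul_mem_upperRoot hF 2 h1 hT0
    simpa using mul_mem_lowerRoot hF 0 h₁ hS1
  have hpow (n : ℕ) : ((u : F) ^ n) ^ 2 ∈ H.lowerRoot 2 := by
    induction n with
    | zero => simpa using h1
    | succ n ih =>
      convert key ih using 1
      ring
  have hsq (x : F) : x ^ 2 ∈ H.lowerRoot 2 := by
    rcases eq_or_ne x 0 with rfl | hx
    · simp
    · obtain ⟨n, hn⟩ := mem_powers_iff_mem_zpowers.mpr (hu (Units.mk0 x hx))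
      simpa [← Units.val_pow_eq_pow_val, show u ^ n = Units.mk0 x hx from hn] using hpow n
  have hT2 (x : F) : x ∈ H.lowerRoot 2 := by
    -- `4x = (x + 1)² - (x - 1)²`, and division by `4` is possible.
    apply AddSubgroup.mem_of_two_nsmul_mem hF
    apply AddSubgroup.mem_of_two_nsmul_mem hF
    convert sub_mem (hsq (x + 1)) (hsq (x - 1)) using 1
    simp only [nsmul_eq_mul]
    push_cast
    ring
  have hS2 (x : F) : x ∈ H.upperRoot 2 := by
    have h := sq_mul_mem_upperRoot u h₃ (hT2 (((u : F) ^ 2)⁻¹ * x))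
    rwa [mul_inv_cancel_left₀ (pow_ne_zero 2 u.ne_zero)] at h
  have hT0 (x : F) : x ∈ H.lowerRoot 0 := by simpa using mul_mem_lowerRoot hF 1 h₂ (hS2 x)
  have hT1 (x : F) : x ∈ H.lowerRoot 1 := by simpa using mul_mem_lowerRoot hF 2 (hS2 x) h₁
  have hS0 (x : F) : x ∈ H.upperRoot 0 := by simpa using mul_mem_upperRoot hF 1 (hT1 1) (hT2 x)
  have hS1 (x : F) : x ∈ H.upperRoot 1 := by simpa using mul_mem_upperRoot hF 2 (hT2 1) (hT0 x)
  simp only [AddSubgroup.eq_top_iff']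
  fin_cases i
  exacts [⟨hS0, hT0⟩, ⟨hS1, hT1⟩, ⟨hS2, hT2⟩]

/-- Here each root group is `0` or `F`, so one element of each has to be exhibited. -/
theorem upperRoot_lowerRoot_eq_top_of_card_eq_two [Finite F] (hF : Nat.card F = 2) (u : Fˣ)
    (h₁ : 1 ∈ H.upperRoot 0) (h₂ : 1 ∈ H.upperRoot 1)
    (h₃ : g₃Rep u ∈ H.lift) (i : Fin 3) : H.upperRoot i = ⊤ ∧ H.lowerRoot i = ⊤ := by
  have hsq (x : F) : x = 0 ∨ x = 1 := by
    have := Fintype.ofFinite F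
    have h := FiniteField.pow_card x
    rw [← Nat.card_eq_fintype_card, hF] at h
    have h' : x * (x - 1) = 0 := by linear_combination h
    exact (mul_eq_zero.mp h').imp id sub_eq_zero.mp
  have h2 : (2 : F) = 0 := by
    rcases hsq 2 with h | h
    · exact h
    · exact absurd (by linear_combination h) (one_ne_zero (α := F))
  have : CharP F 2 := CharTwo.of_one_ne_zero_of_two_eq_zero one_ne_zero h2
  have hu : u = 1 := Units.ext ((hsq u).resolve_left u.ne_zero)
  have htop (K : AddSubgroup F) (h : 1 ∈ K) : K = ⊤ := by
    rw [AddSubgroup.eq_top_iff']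
    intro x
    rcases hsq x with rfl | rfl
    exacts [zero_mem _, h]
  subst hu
  have hc := conj_mem_lift h₃
  rw [mem_upperRoot] at h₁ h₂
  rw [single_zero_eq_vec] at h₁
  rw [single_one_eq_vec] at h₂
  have hT0 : lower ![1, 0, 0] ∈ H.lift := by
    have h := mul_mem_lift hc (mul_mem_lift h₂ h₃)
    rwa [conj_g₃Rep_one_mul_upper_one_mul] at h
  have hT1 : lower ![0, 1, 0] ∈ H.lift := by
    have h := mul_mem_lift hc (mul_mem_lift h₁ h₃)
    rwa [conj_g₃Rep_one_mul_upper_zero_mul] at h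
  have hT2 : (1 : F) ∈ H.lowerRoot 2 := by
    have h := mul_mem_lift h₁ (mul_mem_lift hT0 (mul_mem_lift hc (mul_mem_lift hT1 h₂)))
    rw [upper_mul_lower_mul_conj_g₃Rep_one] at h
    rwa [mem_lowerRoot, single_two_eq_vec]
  have hS2 : (1 : F) ∈ H.upperRoot 2 := by
    simpa using sq_mul_mem_upperRoot 1 h₃ hT2
  rw [← single_zero_eq_vec] at h₁ hT0
  rw [← single_one_eq_vec] at h₂ hT1
  fin_cases i
  exacts [⟨htop _ h₁, htop _ hT0⟩, ⟨htop _ h₂, htop _ hT1⟩, ⟨htop _ hS2, htop _ hT2⟩]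

end Subloop

/-! ### The elements of order three -/

namespace Paige

/-- `M³ = -1` represents the identity, and `α ≠ 0` keeps `M` from being `±1`. -/
theorem order_mk_eq_three (M : VectorMatrix F) (hd : M.det = 1) (ht : M.a + M.b = 1)
    (hα : M.α ≠ 0) : order (mk M hd) = 3 := by
  have : Fact (Nat.Prime 3) := ⟨Nat.prime_three⟩
  refine Function.minimalPeriod_eq_prime ?_ ?_
  · exact Quotient.sound (Or.inr (mul_mul_mul_one M hd ht))
  · intro h
    have h' : mk M hd = 1 := (mul_one (mk M hd)).symm.trans h
    rcases Quotient.exact h' with h | h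
    · exact hα (congrArg VectorMatrix.α h)
    · exact hα ((congrArg VectorMatrix.α h).trans neg_zero)

theorem g₁_eq_mk : g₁ F = mk (upper (Pi.single 0 1)) (det_upper _) := by
  refine congrArg (Quotient.mk _) (Subtype.ext ?_)
  ext i
  · rfl
  · fin_cases i <;> simp [upper]
  · rfl
  · rfl

theorem g₂_eq_mk : g₂ F = mk (upper (Pi.single 1 1)) (det_upper _) := by
  refine congrArg (Quotient.mk _) (Subtype.ext ?_)
  ext i
  · rfl
  · fin_cases i <;> simp [upper]
  · rfl
  · rfl

theorem g₃_eq_mk (u : Fˣ) : g₃ u = mk (g₃Rep u) (det_g₃Rep u) := rfl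

theorem g₄_eq_mk (u : Fˣ) : g₄ u =
    mk { a := 0, α := ![0, 0, (u : F)], β := ![0, (u : F), -(u : F)⁻¹], b := 1 }
      (by simp [det, dotProduct, Fin.sum_univ_three]) := by
  refine congrArg (Quotient.mk _) (Subtype.ext ?_)
  ext i
  · simp [mul_def]
  · fin_cases i <;> simp [mul_def]
  · fin_cases i <;> simp [mul_def, cross_apply]
  · simp [mul_def]

theorem g₅_eq_mk (u : Fˣ) : g₅ u =
    mk { a := 0, α := ![0, 0, (u : F)], β := ![-(u : F), 0, -(u : F)⁻¹], b := 1 }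
      (by simp [det, dotProduct, Fin.sum_univ_three]) := by
  refine congrArg (Quotient.mk _) (Subtype.ext ?_)
  ext i
  · simp [mul_def]
  · fin_cases i <;> simp [mul_def]
  · fin_cases i <;> simp [mul_def, cross_apply]
  · simp [mul_def]

theorem order_g₃ (u : Fˣ) : order (g₃ u) = 3 :=
  order_mk_eq_three _ (det_g₃Rep u) (by simp [g₃Rep])
    (Function.ne_iff.mpr ⟨2, by simp [g₃Rep]⟩)

theorem order_g₄ (u : Fˣ) : order (g₄ u) = 3 := by
  rw [g₄_eq_mk]
  exact order_mk_eq_three _ _ (by simp) (Function.ne_iff.mpr ⟨2, by simp⟩)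

theorem order_g₅ (u : Fˣ) : order (g₅ u) = 3 := by
  rw [g₅_eq_mk]
  exact order_mk_eq_three _ _ (by simp) (Function.ne_iff.mpr ⟨2, by simp⟩)

/-- Vanishing of a coordinate does not depend on the sign of the representative. -/
theorem mk_ne_mk {M N : VectorMatrix F} {hM : M.det = 1} {hN : N.det = 1} (i : Fin 3)
    (h : M.β i = 0) (h' : N.β i ≠ 0) : mk M hM ≠ mk N hN := by
  intro e
  rcases Quotient.exact e with e | e
  · exact h' ((congrFun (congrArg VectorMatrix.β e) i).symm.trans h)
  · exact h' (neg_eq_zero.mp ((congrFun (congrArg VectorMatrix.β e) i).symm.trans h))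

theorem g₃_ne_g₄ (u : Fˣ) : g₃ u ≠ g₄ u := by
  rw [g₃_eq_mk, g₄_eq_mk]
  exact mk_ne_mk 1 (by simp [g₃Rep]) (by simp)

theorem g₃_ne_g₅ (u : Fˣ) : g₃ u ≠ g₅ u := by
  rw [g₃_eq_mk, g₅_eq_mk]
  exact mk_ne_mk 0 (by simp [g₃Rep]) (by simp)

theorem g₄_ne_g₅ (u : Fˣ) : g₄ u ≠ g₅ u := by
  rw [g₄_eq_mk, g₅_eq_mk]
  exact mk_ne_mk 0 (by simp) (by simp)

theorem generates_g₃_g₄_g₅ [Finite F] (hF : Odd (Nat.card F) ∨ Nat.card F = 2) (u : Fˣ)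
    (hu : ∀ v : Fˣ, v ∈ Subgroup.zpowers u) : Generates {g₃ u, g₄ u, g₅ u} := by
  rw [Generates, Set.eq_univ_iff_forall]
  rintro ⟨M, hM⟩ H hs
  have h₃ : g₃ u ∈ H.carrier := hs (by simp)
  have h₁ : g₁ F ∈ H.carrier := by
    have h := H.ldiv_mem h₃ (hs (by simp : g₄ u ∈ _))
    rwa [g₄, Loop.ldiv_mul] at h
  have h₂ : g₂ F ∈ H.carrier := by
    have h := H.ldiv_mem h₃ (hs (by simp : g₅ u ∈ _))
    rwa [g₅, Loop.ldiv_mul] at h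
  rw [g₁_eq_mk] at h₁
  rw [g₂_eq_mk] at h₂
  have key (i : Fin 3) : H.upperRoot i = ⊤ ∧ H.lowerRoot i = ⊤ := by
    rcases hF with hF | hF
    · exact Subloop.upperRoot_lowerRoot_eq_top_of_odd hF u hu ⟨_, h₁⟩ ⟨_, h₂⟩ ⟨_, h₃⟩ i
    · exact Subloop.upperRoot_lowerRoot_eq_top_of_card_eq_two hF u ⟨_, h₁⟩ ⟨_, h₂⟩ ⟨_, h₃⟩ i
  obtain ⟨_, h⟩ := Subloop.mem_lift_of_det_eq_one
    (fun i t => (AddSubgroup.eq_top_iff' _).mp (key i).1 t)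
    (fun i t => (AddSubgroup.eq_top_iff' _).mp (key i).2 t) M hM
  exact h

end Paige
end PaigeLoop

theorem mainTheorem4 {F : Type*} [Field F] [Finite F]
    (hq : (Odd (Nat.card F) ∧ Nat.card F ≠ 9) ∨ Nat.card F = 2) :
    (∃ x y z : PaigeLoop.Paige F, x ≠ y ∧ x ≠ z ∧ y ≠ z ∧
      PaigeLoop.order x = 3 ∧ PaigeLoop.order y = 3 ∧ PaigeLoop.order z = 3 ∧
      PaigeLoop.Generates {x, y, z}) ∧
    ∀ u : Fˣ, (∀ v : Fˣ, v ∈ Subgroup.zpowers u) →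
      PaigeLoop.Paige.g₃ u ≠ PaigeLoop.Paige.g₄ u ∧
      PaigeLoop.Paige.g₃ u ≠ PaigeLoop.Paige.g₅ u ∧
      PaigeLoop.Paige.g₄ u ≠ PaigeLoop.Paige.g₅ u ∧
      PaigeLoop.order (PaigeLoop.Paige.g₃ u) = 3 ∧
      PaigeLoop.order (PaigeLoop.Paige.g₄ u) = 3 ∧
      PaigeLoop.order (PaigeLoop.Paige.g₅ u) = 3 ∧
      PaigeLoop.Generates
        {PaigeLoop.Paige.g₃ u, PaigeLoop.Paige.g₄ u, PaigeLoop.Paige.g₅ u} := by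
  have key : ∀ u : Fˣ, (∀ v : Fˣ, v ∈ Subgroup.zpowers u) →
      PaigeLoop.Generates
        {PaigeLoop.Paige.g₃ u, PaigeLoop.Paige.g₄ u, PaigeLoop.Paige.g₅ u} :=
    PaigeLoop.Paige.generates_g₃_g₄_g₅ (hq.imp And.left id)
  obtain ⟨u, hu⟩ := IsCyclic.exists_generator (α := Fˣ)
  exact ⟨⟨_, _, _, PaigeLoop.Paige.g₃_ne_g₄ u, PaigeLoop.Paige.g₃_ne_g₅ u,
      PaigeLoop.Paige.g₄_ne_g₅ u, PaigeLoop.Paige.order_g₃ u, PaigeLoop.Paige.order_g₄ u,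
      PaigeLoop.Paige.order_g₅ u, key u hu⟩,
    fun u hu => ⟨PaigeLoop.Paige.g₃_ne_g₄ u, PaigeLoop.Paige.g₃_ne_g₅ u,
      PaigeLoop.Paige.g₄_ne_g₅ u, PaigeLoop.Paige.order_g₃ u, PaigeLoop.Paige.order_g₄ u,
      PaigeLoop.Paige.order_g₅ u, key u hu⟩⟩
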